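/- **Setting.** Let $\mathcal Z$ be a nonempty compact space (for instance a finite set), $\mathcal H_k$ a reproducing kernel Hilbert space of real functions on $\mathcal Z$ with continuous kernel $k$, $k(\mathbf z,\mathbf z)\le \bar k$ for all $\mathbf z$, where $\bar k>0$, and let $\lambda>0$ be the noise variance used in Gaussian-process (GP) regression. Let $\mathbf f=(f_1,\dots,f_M)$ with $f_m\in\mathcal H_k$, $\|f_m\|_{\mathcal H_k}\le B_m$. At each step $n=1,2,\dots$ a batch of $q\ge1$ points $\mathbf z_{n,1},\dots,\mathbf z_{n,q}\in\mathcal Z$ is evaluated ($q=1$: a sequence of single queries) and $y_{m,n,j}=f_m(\mathbf z_{n,j})+\epsilon_{m,n,j}$ is observed, with independent $\sigma$-sub-Gaussian noise. Let $\mathcal Z_n$ be the set of points evaluated in steps $1,\dots,n$. For $\mathbf r\in\mathbb R^M$ let $HV(\mathcal P;\mathbf r)$ be the Lebesgue measure of $\{\mathbf y\ge\mathbf r:\ \mathbf y\le \mathbf p\text{ for some }\mathbf p\in\mathcal P\}$, $HV_n=HV(\mathbf f(\mathcal Z_n);\mathbf r)$, $HV^\star=HV(\mathcal P^\star;\mathbf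 r)$ with $\mathcal P^\star$ the set of objective vectors of Pareto-optimal points (componentwise maximization), and $R_N^{HV}=\sum_{n=1}^N(HV^\star-HV_n)$. *Hypervolume decomposition.* For weights $\mathbf w_1,\dots,\mathbf w_K\in\mathbb R_+^M$ there are $\alpha_1,\dots,\alpha_K\ge0$ and $\varepsilon_K\ge0$ such that, with $s_\kappa=\mathbf w_\kappa^\top\mathbf f$, for every nonempty finite $A\subset\mathcal Z$, $$HV^\star-HV(\mathbf f(A);\mathbf r)\le\varepsilon_K+\sum_{\kappa=1}^K\alpha_\kappa\Big(\max_{\mathcal Z}s_\kappa-\max_A s_\kappa\Big).$$ *GP-UCB on the scalarized objectives.* Let $\mu^{(\kappa)}_{n-1}$, $\sigma_{n-1}$ be the posterior mean and standard deviation of GP regression (zero prior mean, covariance $k$, noise variance $\lambda$) for $s_\kappa$, given the scalarized observations $\mathbf w_\kappa^\top\mathbf y$ of the steps before $n$, and let $0\le\beta_1\le\beta_2\le\dots$. For some integer $T\ge1$, among any $T$ consecutive steps and for each $\kappa$ there is a step $n$ at which one of the evaluated points maximizes $\mu^{(\kappa)}_{n-1}+\sqrt{\beta_n}\,\sigma_{n-1}$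 over $\mathcal Z$. ($T=1$: every direction is served at each step; $q=1$, $T=K$: directions are served cyclically, one evaluation per step.) Let $\gamma_N(\mathcal Z)=\sup_{x_1,\dots,x_N\in\mathcal Z}\tfrac12\log\det\big(I+\lambda^{-1}[k(x_a,x_b)]_{a,b}\big)$ be the maximum information gain. For $\delta\in(0,1)$, call $(\beta_n)$ *valid up to $N$* if, with probability at least $1-\delta$, $|s_\kappa(\mathbf z)-\mu^{(\kappa)}_{n-1}(\mathbf z)|\le\sqrt{\beta_n}\,\sigma_{n-1}(\mathbf z)$ for all $\kappa$, all $\mathbf z\in\mathcal Z$ and all $n\le N$. **Proposition.** There is a constant $C_0>0$, depending only on $\lambda$ and $\bar k$, such that in every such setting: 1. There is a nonnegative nondecreasing sequence $(\beta_n)$, depending on neither the objectives $f_m$ (beyond the bounds $B_m$), the law of the noise (beyond $\sigma$), nor the way the points are queried, for which with probability at least $1-\delta$ the above confidence bounds hold for all $n$ simultaneously; in particular it is valid up to every $N$. 2. Whenever the points are queried by GP-UCB as above with multipliers $(\beta_n)$ that are valid up to $N$, then with probability at least $1-\delta$, with $C=C_0\sqrt T$ (so $C=C_0$ if every direction is served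 at each step), $$R_N^{HV}\le N\,\varepsilon_K+C\Big(\sum_{\kappa=1}^K\alpha_\kappa\Big)\sqrt{N\,\beta_N\,\gamma_N(\mathcal Z)}.$$ -/

import Mathlib

open MeasureTheory ProbabilityTheory
open scoped NNReal Matrix

noncomputable section

namespace HVBandit

/-! ### Gaussian-process regression -/

/-- The real-valued reproducing kernel of an RKHS `H` of real functions on `Z`. -/
def kern {Z : Type*} (H : Type*) [NormedAddCommGroup H] [InnerProductSpace ℝ H] [CompleteSpace H]
    [RKHS ℝ H Z ℝ] (x y : Z) : ℝ :=
  RKHS.kernel H x y 1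

/-- The kernel matrix of a finite family of points. -/
def gram {Z ι : Type*} (k : Z → Z → ℝ) (x : ι → Z) : Matrix ι ι ℝ :=
  Matrix.of fun a b => k (x a) (x b)

/-- The vector of kernel values between a point and a finite family of points. -/
def crossCov {Z ι : Type*} (k : Z → Z → ℝ) (x : ι → Z) (t : Z) : ι → ℝ :=
  fun a => k t (x a)

/-- GP posterior mean at `t`, given observations `y` at the points `x`, prior covariance `k`
and noise variance `lam`. -/
def postMean {Z ι : Type*} [Fintype ι] [DecidableEq ι] (k : Z → Z → ℝ) (lam : ℝ)
    (x : ι → Z) (y : ι → ℝ) (t : Z) : ℝ :=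
  crossCov k x t ⬝ᵥ ((gram k x + lam • (1 : Matrix ι ι ℝ))⁻¹ *ᵥ y)

/-- GP posterior variance at `t`, given observations at the points `x`. -/
def postVar {Z ι : Type*} [Fintype ι] [DecidableEq ι] (k : Z → Z → ℝ) (lam : ℝ)
    (x : ι → Z) (t : Z) : ℝ :=
  k t t - crossCov k x t ⬝ᵥ ((gram k x + lam • (1 : Matrix ι ι ℝ))⁻¹ *ᵥ crossCov k x t)

/-- Mutual information between the GP and its noisy observations at the points `x`. -/
def infoGain {Z ι : Type*} [Fintype ι] [DecidableEq ι] (k : Z → Z → ℝ) (lam : ℝ)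
    (x : ι → Z) : ℝ :=
  (1 / 2) * Real.log (1 + lam⁻¹ • gram k x).det

/-- The maximum information gain `γ_N(Z)` of `N` observations over the domain `Z`. -/
def maxInfoGain {Z : Type*} (k : Z → Z → ℝ) (lam : ℝ) (N : ℕ) : ℝ :=
  ⨆ x : Fin N → Z, infoGain k lam x

/-! ### GP-UCB on scalarized objectives

Along one realization, `z i j` is the `j`-th of the `q` points evaluated at step `i + 1`, and
`e m i j` is the noise of the corresponding observation of the `m`-th objective. -/

/-- The scalarized objective `w ᵀ f`. -/
def scal {Z : Type*} {M : ℕ} (w : Fin M → ℝ) (f : Z → Fin M → ℝ) (x : Z) : ℝ :=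
  ∑ m, w m * f x m

/-- The points evaluated in the first `n` steps, as an indexed family. -/
def queries {Z : Type*} {q : ℕ} (z : ℕ → Fin q → Z) (n : ℕ) : Fin n × Fin q → Z :=
  fun a => z a.1 a.2

/-- The scalarized observations `w ᵀ y` of the first `n` steps, where `y = f(z) + e`. -/
def scalObs {Z : Type*} {M q : ℕ} (w : Fin M → ℝ) (f : Z → Fin M → ℝ)
    (e : Fin M → ℕ → Fin q → ℝ) (z : ℕ → Fin q → Z) (n : ℕ) : Fin n × Fin q → ℝ :=
  fun a => ∑ m, w m * (f (z a.1 a.2) m + e m a.1 a.2)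

/-- Posterior mean of the scalarized objective `w ᵀ f` after `n` steps. -/
def scalMean {Z : Type*} {M q : ℕ} (k : Z → Z → ℝ) (lam : ℝ) (w : Fin M → ℝ)
    (f : Z → Fin M → ℝ) (e : Fin M → ℕ → Fin q → ℝ) (z : ℕ → Fin q → Z) (n : ℕ) (x : Z) : ℝ :=
  postMean k lam (queries z n) (scalObs w f e z n) x

/-- Posterior standard deviation after `n` steps. -/
def postStd {Z : Type*} {q : ℕ} (k : Z → Z → ℝ) (lam : ℝ) (z : ℕ → Fin q → Z) (n : ℕ)
    (x : Z) : ℝ :=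
  √(postVar k lam (queries z n) x)

/-- The upper confidence bound for `w ᵀ f` used at step `n + 1`, that is, after `n` steps. -/
def ucb {Z : Type*} {M q : ℕ} (k : Z → Z → ℝ) (lam : ℝ) (β : ℕ → ℝ) (w : Fin M → ℝ)
    (f : Z → Fin M → ℝ) (e : Fin M → ℕ → Fin q → ℝ) (z : ℕ → Fin q → Z) (n : ℕ) (x : Z) : ℝ :=
  scalMean k lam w f e z n x + √(β (n + 1)) * postStd k lam z n x

/-- GP-UCB is applied to every scalarized objective: among any `T` consecutive steps there is, for
each direction `κ`, one at which an evaluated point maximizes the upper confidence bound of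
`w κ ᵀ f`. For `T = 1` every direction is served at each step; `q = 1`, `T = K` covers the cyclic
rule with one evaluation per step. -/
def IsGPUCB {Z : Type*} {K M q : ℕ} (k : Z → Z → ℝ) (lam : ℝ) (β : ℕ → ℝ) (T : ℕ)
    (w : Fin K → Fin M → ℝ) (f : Z → Fin M → ℝ) (e : Fin M → ℕ → Fin q → ℝ)
    (z : ℕ → Fin q → Z) : Prop :=
  ∀ (κ : Fin K) (n : ℕ), ∃ i, n ≤ i ∧ i < n + T ∧ ∃ j : Fin q,
    ∀ x : Z, ucb k lam β (w κ) f e z i x ≤ ucb k lam β (w κ) f e z i (z i j)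

/-- The uniform confidence event up to horizon `N`: at every step `n + 1 ≤ N`, for every
scalarized objective and at every point of the domain, the truth is within `√β_{n+1}` posterior
standard deviations of the posterior mean. -/
def ConfidenceEvent {Z : Type*} {K M q : ℕ} (k : Z → Z → ℝ) (lam : ℝ) (β : ℕ → ℝ)
    (w : Fin K → Fin M → ℝ) (f : Z → Fin M → ℝ) (e : Fin M → ℕ → Fin q → ℝ)
    (z : ℕ → Fin q → Z) (N : ℕ) : Prop :=
  ∀ κ : Fin K, ∀ n < N, ∀ x : Z,
    |scal (w κ) f x - scalMean k lam (w κ) f e z n x| ≤ √(β (n + 1)) * postStd k lam z n x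

/-! ### Hypervolume and its regret -/

/-- The hypervolume dominated by `S` with respect to the reference point `r`. -/
def hv {M : ℕ} (S : Set (Fin M → ℝ)) (r : Fin M → ℝ) : ℝ :=
  (volume {y : Fin M → ℝ | r ≤ y ∧ ∃ p ∈ S, y ≤ p}).toReal

/-- The objective values of the Pareto-optimal points (`<` on `Fin M → ℝ`: at least as large in
every component and different). -/
def paretoFront {Z : Type*} {M : ℕ} (f : Z → Fin M → ℝ) : Set (Fin M → ℝ) :=
  {p | ∃ x, f x = p ∧ ∀ x', ¬ f x < f x'}

/-- The set of points evaluated in the first `n` steps. -/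
def evaluated {Z : Type*} {q : ℕ} (z : ℕ → Fin q → Z) (n : ℕ) : Set Z :=
  {x | ∃ i < n, ∃ j, z i j = x}

/-- Cumulative hypervolume regret `∑_{n=1}^N (HV⋆ - HV_n)`. -/
def hvRegret {Z : Type*} {M q : ℕ} (f : Z → Fin M → ℝ) (r : Fin M → ℝ)
    (z : ℕ → Fin q → Z) (N : ℕ) : ℝ :=
  ∑ n ∈ Finset.Icc 1 N, (hv (paretoFront f) r - hv (f '' evaluated z n) r)

/-- The optimality gap of an evaluated set `A` for the scalar objective `s`. -/
def scalGap {Z : Type*} (s : Z → ℝ) (A : Set Z) : ℝ :=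
  (⨆ x, s x) - sSup (s '' A)

/-- Hypervolume decomposition: the hypervolume deficiency of every evaluated (finite, nonempty) set
is at most `ε` plus the `α`-weighted sum of the scalarized optimality gaps. -/
structure HVDecomposition {Z : Type*} {K M : ℕ} (f : Z → Fin M → ℝ) (r : Fin M → ℝ)
    (w : Fin K → Fin M → ℝ) (α : Fin K → ℝ) (ε : ℝ) : Prop where
  weights_nonneg : ∀ κ m, 0 ≤ w κ m
  coeff_nonneg : ∀ κ, 0 ≤ α κ
  error_nonneg : 0 ≤ ε
  deficiency_le : ∀ A : Set Z, A.Finite → A.Nonempty →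
    hv (paretoFront f) r - hv (f '' A) r ≤ ε + ∑ κ, α κ * scalGap (scal (w κ) f) A

/-! ### Randomness -/

/-- Independent `σ`-sub-Gaussian observation noise. -/
structure SubGaussianNoise {Ω : Type*} [MeasurableSpace Ω] (P : Measure Ω) {M q : ℕ} (σ : ℝ≥0)
    (noise : Fin M → ℕ → Fin q → Ω → ℝ) : Prop where
  indep : iIndepFun (fun a : Fin M × ℕ × Fin q => noise a.1 a.2.1 a.2.2) P
  subGaussian : ∀ m i j, HasSubgaussianMGF (noise m i j) (σ ^ 2) P

/-- `E` holds with probability at least `1 - δ`: its complement has (outer) probability at most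
`δ`. -/
def HoldsWithProb {Ω : Type*} [MeasurableSpace Ω] (P : Measure Ω) (δ : ℝ) (E : Ω → Prop) : Prop :=
  P {ω | ¬ E ω} ≤ ENNReal.ofReal δ

end HVBandit

end

/-! The argument is pathwise: all randomness is confined to an event on which the noise is bounded.

Regret. In a feature space with `k x y = ⟪φ x, φ y⟫`, the posterior variance is the minimum of a
ridge objective, so it decreases as data are added. Adding a point multiplies `det (1 + lam⁻¹ •
gram)` by `1 + lam⁻¹ * postVar` (Schur complement), so the posterior variances along a query
sequence sum to at most a constant times the information gain (`sum_postVar_le`). Under the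
confidence bounds, a UCB maximizer leaves a gap of at most two confidence widths. Cauchy–Schwarz
over the steps gives `sum_scalGap_le`, and the hypervolume decomposition turns it into
`hvRegret_le`.

Multipliers. The error of the posterior mean is bounded by the posterior deviation times the RKHS
norm plus a multiple of the total absolute noise (`abs_sub_postMean_le`). A union bound over all
noise variables gives deterministic thresholds (`exists_thresholds`). The resulting multipliers are
crude, but hold for arbitrary query rules. -/

noncomputable section

namespace HVBandit

open scoped RealInnerProductSpace

/-! ### Posterior variance as a regularized least-squares residual -/

section Posterior

variable {Z E ι : Type*} [NormedAddCommGroup E] [InnerProductSpace ℝ E] [Fintype ι] [DecidableEq ι]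
  {k : Z → Z → ℝ} {φ : Z → E} {lam : ℝ}

/-- The coefficients of the observations in the GP posterior mean at `t`. -/
def postWeights (k : Z → Z → ℝ) (lam : ℝ) (x : ι → Z) (t : Z) : ι → ℝ :=
  (gram k x + lam • (1 : Matrix ι ι ℝ))⁻¹ *ᵥ crossCov k x t

omit [Fintype ι] [DecidableEq ι] in
lemma gram_eq_matrix_gram (hk : ∀ x y, k x y = ⟪φ x, φ y⟫) (x : ι → Z) :
    gram k x = Matrix.gram ℝ (φ ∘ x) := by
  ext a b
  simp [gram, hk, Matrix.gram_apply]

lemma posDef_gram_add (hk : ∀ x y, k x y = ⟪φ x, φ y⟫) (hlam : 0 < lam) (x : ι → Z) :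
    (gram k x + lam • (1 : Matrix ι ι ℝ)).PosDef := by
  rw [gram_eq_matrix_gram hk]
  exact Matrix.PosDef.posSemidef_add (Matrix.posSemidef_gram ℝ _) (Matrix.PosDef.one.smul hlam)

lemma isUnit_det_gram_add (hk : ∀ x y, k x y = ⟪φ x, φ y⟫) (hlam : 0 < lam) (x : ι → Z) :
    IsUnit (gram k x + lam • (1 : Matrix ι ι ℝ)).det :=
  (posDef_gram_add hk hlam x).det_pos.ne'.isUnit

omit [Fintype ι] in
lemma transpose_gram_add (hk : ∀ x y, k x y = ⟪φ x, φ y⟫) (x : ι → Z) :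
    (gram k x + lam • (1 : Matrix ι ι ℝ))ᵀ = gram k x + lam • (1 : Matrix ι ι ℝ) := by
  ext a b
  simp [gram, hk, real_inner_comm, Matrix.one_apply, eq_comm]

lemma gram_add_mulVec_postWeights (hk : ∀ x y, k x y = ⟪φ x, φ y⟫) (hlam : 0 < lam)
    (x : ι → Z) (t : Z) :
    (gram k x + lam • (1 : Matrix ι ι ℝ)) *ᵥ postWeights k lam x t = crossCov k x t := by
  rw [postWeights, Matrix.mulVec_mulVec, Matrix.mul_nonsing_inv _ (isUnit_det_gram_add hk hlam x),
    Matrix.one_mulVec]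

lemma postMean_eq (hk : ∀ x y, k x y = ⟪φ x, φ y⟫) (x : ι → Z) (y : ι → ℝ) (t : Z) :
    postMean k lam x y t = postWeights k lam x t ⬝ᵥ y := by
  rw [postMean, postWeights, Matrix.dotProduct_mulVec, ← Matrix.mulVec_transpose,
    Matrix.transpose_nonsing_inv, transpose_gram_add hk]

lemma residual_expand (hk : ∀ x y, k x y = ⟪φ x, φ y⟫) (x : ι → Z) (t : Z) (b : ι → ℝ) :
    ‖φ t - ∑ a, b a • φ (x a)‖ ^ 2 + lam * ∑ a, b a ^ 2 =
      k t t - 2 * (b ⬝ᵥ crossCov k x t) +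
        b ⬝ᵥ ((gram k x + lam • (1 : Matrix ι ι ℝ)) *ᵥ b) := by
  rw [norm_sub_sq_real, ← real_inner_self_eq_norm_sq, ← real_inner_self_eq_norm_sq, hk t t,
    Matrix.add_mulVec, dotProduct_add, Matrix.smul_mulVec, Matrix.one_mulVec, dotProduct_smul]
  have h1 : ⟪φ t, ∑ a, b a • φ (x a)⟫ = b ⬝ᵥ crossCov k x t := by
    simp [inner_sum, real_inner_smul_right, dotProduct, crossCov, hk]
  have h2 : ⟪∑ a, b a • φ (x a), ∑ a, b a • φ (x a)⟫ = b ⬝ᵥ (gram k x *ᵥ b) := by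
    simp only [inner_sum, sum_inner, real_inner_smul_right, real_inner_smul_left, dotProduct,
      gram, hk, Matrix.mulVec, Matrix.of_apply, Finset.mul_sum]
    rw [Finset.sum_comm]
    exact Finset.sum_congr rfl fun i _ => Finset.sum_congr rfl fun j _ => by ring
  have h3 : b ⬝ᵥ b = ∑ a, b a ^ 2 := by simp [dotProduct, sq]
  rw [h1, h2, h3, smul_eq_mul]
  ring

lemma postVar_eq_sub_dotProduct (x : ι → Z) (t : Z) :
    postVar k lam x t = k t t - crossCov k x t ⬝ᵥ postWeights k lam x t := rfl

lemma postVar_eq_residual (hk : ∀ x y, k x y = ⟪φ x, φ y⟫) (hlam : 0 < lam) (x : ι → Z) (t : Z) :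
    postVar k lam x t = ‖φ t - ∑ a, postWeights k lam x t a • φ (x a)‖ ^ 2 +
      lam * ∑ a, postWeights k lam x t a ^ 2 := by
  rw [residual_expand hk, gram_add_mulVec_postWeights hk hlam, postVar_eq_sub_dotProduct,
    dotProduct_comm]
  ring

/-- Completing the square: the ridge objective at `b` exceeds its value at the posterior weights `a`
by `(b - a)ᵀ A (b - a)`, with `A` positive definite. -/
lemma postVar_le_residual (hk : ∀ x y, k x y = ⟪φ x, φ y⟫) (hlam : 0 < lam) (x : ι → Z) (t : Z)
    (b : ι → ℝ) :
    postVar k lam x t ≤ ‖φ t - ∑ a, b a • φ (x a)‖ ^ 2 + lam * ∑ a, b a ^ 2 := by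
  rw [residual_expand hk, postVar_eq_sub_dotProduct]
  set A := gram k x + lam • (1 : Matrix ι ι ℝ) with hA
  set a := postWeights k lam x t
  have hc : A *ᵥ a = crossCov k x t := gram_add_mulVec_postWeights hk hlam x t
  have hnn : 0 ≤ (b - a) ⬝ᵥ (A *ᵥ (b - a)) := by
    simpa using (posDef_gram_add hk hlam x).posSemidef.dotProduct_mulVec_nonneg (b - a)
  have hsymm : a ⬝ᵥ (A *ᵥ b) = b ⬝ᵥ (A *ᵥ a) := by
    rw [Matrix.dotProduct_mulVec, ← Matrix.mulVec_transpose, hA, transpose_gram_add hk,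
      dotProduct_comm]
  rw [Matrix.mulVec_sub, sub_dotProduct, dotProduct_sub, dotProduct_sub, hsymm, hc] at hnn
  rw [dotProduct_comm (crossCov k x t) a]
  linarith

lemma postVar_nonneg (hk : ∀ x y, k x y = ⟪φ x, φ y⟫) (hlam : 0 < lam) (x : ι → Z) (t : Z) :
    0 ≤ postVar k lam x t := by
  rw [postVar_eq_residual hk hlam]
  positivity

lemma postVar_le_diag (hk : ∀ x y, k x y = ⟪φ x, φ y⟫) (hlam : 0 < lam) (x : ι → Z) (t : Z) :
    postVar k lam x t ≤ k t t := by
  simpa [hk] using postVar_le_residual hk hlam x t 0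

lemma postVar_of_isEmpty [IsEmpty ι] (x : ι → Z) (t : Z) : postVar k lam x t = k t t := by
  simp [postVar, dotProduct]

omit [DecidableEq ι] in
lemma sum_extend_zero {κ F : Type*} [Fintype κ] [AddCommMonoid F] {g : κ → ι}
    (hg : Function.Injective g) (b : κ → ℝ) (u : ι → ℝ → F) (hu : ∀ i, u i 0 = 0) :
    ∑ i, u i (Function.extend g b 0 i) = ∑ j, u (g j) (b j) := by
  classical
  rw [← Finset.sum_subset (Finset.subset_univ (Finset.univ.image g)),
    Finset.sum_image fun _ _ _ _ h => hg h]
  · simp [hg.extend_apply]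
  · intro i _ hi
    rw [Function.extend_apply', Pi.zero_apply, hu]
    simpa using hi

/-- Further observations do not increase the posterior variance. -/
lemma postVar_le_postVar_comp {κ : Type*} [Fintype κ] [DecidableEq κ]
    (hk : ∀ x y, k x y = ⟪φ x, φ y⟫) (hlam : 0 < lam)
    (x : ι → Z) (g : κ → ι) (hg : Function.Injective g) (t : Z) :
    postVar k lam x t ≤ postVar k lam (x ∘ g) t := by
  set b := postWeights k lam (x ∘ g) t with hb
  -- The optimal weights for the subfamily, padded with zeros, compete in the larger problem.
  refine (postVar_le_residual hk hlam x t (Function.extend g b 0)).trans_eq ?_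
  rw [postVar_eq_residual hk hlam, ← hb]
  rw [sum_extend_zero hg b (fun i c => c • φ (x i)) (by simp),
    sum_extend_zero hg b (fun _ c => c ^ 2) (by simp)]
  rfl

/-- Deviation of the posterior mean from an element `g` of the feature space observed with
perturbations `e`. -/
lemma abs_sub_postMean_le (hk : ∀ x y, k x y = ⟪φ x, φ y⟫) (hlam : 0 < lam) (x : ι → Z)
    (g : E) (e : ι → ℝ) (t : Z) :
    |⟪g, φ t⟫ - postMean k lam x (fun a => ⟪g, φ (x a)⟫ + e a) t| ≤
      (‖g‖ + (√lam)⁻¹ * ∑ a, |e a|) * √(postVar k lam x t) := by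
  set b := postWeights k lam x t with hb
  have hv := postVar_eq_residual hk hlam x t
  rw [← hb] at hv
  have hsum : 0 ≤ ∑ a, b a ^ 2 := Finset.sum_nonneg fun _ _ => sq_nonneg _
  -- Both terms of the residual identity are nonnegative: one controls the bias, the other each
  -- single weight.
  have h1 : ‖φ t - ∑ a, b a • φ (x a)‖ ≤ √(postVar k lam x t) := by
    apply Real.le_sqrt_of_sq_le
    rw [hv]
    nlinarith
  have h2 (a : ι) : |b a| ≤ (√lam)⁻¹ * √(postVar k lam x t) := by
    rw [← Real.sqrt_inv, ← Real.sqrt_mul (by positivity)]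
    apply Real.abs_le_sqrt
    rw [inv_mul_eq_div, le_div_iff₀ hlam, hv, mul_comm]
    have : b a ^ 2 ≤ ∑ a, b a ^ 2 :=
      Finset.single_le_sum (f := fun a => b a ^ 2) (fun _ _ => sq_nonneg _) (Finset.mem_univ a)
    nlinarith [sq_nonneg ‖φ t - ∑ a, b a • φ (x a)‖]
  have hdecomp : ⟪g, φ t⟫ - postMean k lam x (fun a => ⟪g, φ (x a)⟫ + e a) t =
      ⟪g, φ t - ∑ a, b a • φ (x a)⟫ - ∑ a, b a * e a := by
    rw [postMean_eq hk, ← hb, inner_sub_right, inner_sum]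
    simp only [dotProduct, mul_add, Finset.sum_add_distrib, real_inner_smul_right]
    ring
  rw [hdecomp]
  calc |⟪g, φ t - ∑ a, b a • φ (x a)⟫ - ∑ a, b a * e a|
      ≤ |⟪g, φ t - ∑ a, b a • φ (x a)⟫| + |∑ a, b a * e a| := abs_sub _ _
    _ ≤ ‖g‖ * √(postVar k lam x t) +
        ∑ a, (√lam)⁻¹ * √(postVar k lam x t) * |e a| := by
      refine add_le_add ((abs_real_inner_le_norm _ _).trans (by gcongr)) ?_
      refine (Finset.abs_sum_le_sum_abs _ _).trans (Finset.sum_le_sum fun a _ => ?_)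
      rw [abs_mul]
      exact mul_le_mul_of_nonneg_right (h2 a) (abs_nonneg _)
    _ = _ := by
      rw [← Finset.mul_sum]
      ring

/-! ### Information gain -/

/-- The Schur complement of the old block in the bordered matrix is the scalar `1 + lam⁻¹ *
postVar`. -/
lemma det_gram_sumElim (hk : ∀ x y, k x y = ⟪φ x, φ y⟫) (hlam : 0 < lam) (x : ι → Z) (t : Z) :
    (1 + lam⁻¹ • gram k (Sum.elim x fun _ : Fin 1 => t)).det =
      (1 + lam⁻¹ • gram k x).det * (1 + lam⁻¹ * postVar k lam x t) := by
  set G := gram k x + lam • (1 : Matrix ι ι ℝ) with hG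
  have hA : 1 + lam⁻¹ • gram k x = lam⁻¹ • G := by
    rw [hG, smul_add, smul_smul, inv_mul_cancel₀ hlam.ne', one_smul, add_comm]
  have hGu := isUnit_det_gram_add hk hlam x
  have hmul : (lam⁻¹ • G) * (lam • G⁻¹) = 1 := by
    rw [Matrix.smul_mul, Matrix.mul_smul, smul_smul, inv_mul_cancel₀ hlam.ne', one_smul,
      Matrix.mul_nonsing_inv _ hGu]
  let _ : Invertible (lam⁻¹ • G) := invertibleOfRightInverse _ _ hmul
  have hinv : ⅟(lam⁻¹ • G) = lam • G⁻¹ := rfl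
  have hblock : 1 + lam⁻¹ • gram k (Sum.elim x fun _ : Fin 1 => t) =
      Matrix.fromBlocks (lam⁻¹ • G) (Matrix.replicateCol (Fin 1) (lam⁻¹ • crossCov k x t))
        (Matrix.replicateRow (Fin 1) (lam⁻¹ • crossCov k x t))
        (Matrix.of fun _ _ => 1 + lam⁻¹ * k t t) := by
    rw [← hA]
    ext (a | a) (b | b) <;>
      simp [gram, crossCov, Matrix.one_apply, hk, real_inner_comm, eq_iff_true_of_subsingleton]
  rw [hblock, Matrix.det_fromBlocks₁₁, hinv, hA]
  congr 1
  rw [Matrix.det_unique, Matrix.mul_smul, Matrix.smul_mul, postVar_eq_sub_dotProduct, postWeights,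
    ← hG]
  have h : (Matrix.replicateRow (Fin 1) (lam⁻¹ • crossCov k x t) * G⁻¹ *
      Matrix.replicateCol (Fin 1) (lam⁻¹ • crossCov k x t)) default default =
      lam⁻¹ * (lam⁻¹ * (crossCov k x t ⬝ᵥ (G⁻¹ *ᵥ crossCov k x t))) := by
    rw [Matrix.mul_assoc]
    change (lam⁻¹ • crossCov k x t) ⬝ᵥ (G⁻¹ *ᵥ (lam⁻¹ • crossCov k x t)) = _
    rw [Matrix.mulVec_smul, dotProduct_smul, smul_dotProduct, smul_eq_mul, smul_eq_mul]
  simp only [Matrix.sub_apply, Matrix.smul_apply, h, Matrix.of_apply, smul_eq_mul]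
  field_simp
  ring

lemma det_gram_comp_equiv {κ : Type*} [Fintype κ] [DecidableEq κ] (e : κ ≃ ι) (x : ι → Z) :
    (1 + lam⁻¹ • gram k (x ∘ e)).det = (1 + lam⁻¹ • gram k x).det := by
  rw [← Matrix.det_submatrix_equiv_self e (1 + lam⁻¹ • gram k x)]
  congr 1
  ext a b
  simp [gram, Matrix.one_apply]

end Posterior

section InfoGain

variable {Z E : Type*} [NormedAddCommGroup E] [InnerProductSpace ℝ E]
  {k : Z → Z → ℝ} {φ : Z → E} {lam kmax : ℝ}

/-- Chain rule for the information gain. -/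
lemma infoGain_eq_sum (hk : ∀ x y, k x y = ⟪φ x, φ y⟫) (hlam : 0 < lam) (x : ℕ → Z) (N : ℕ) :
    infoGain k lam (fun i : Fin N => x i) = 1 / 2 * ∑ n ∈ Finset.range N,
      Real.log (1 + lam⁻¹ * postVar k lam (fun i : Fin n => x i) (x n)) := by
  have hpos (n : ℕ) : 0 < 1 + lam⁻¹ * postVar k lam (fun i : Fin n => x i) (x n) := by
    have := postVar_nonneg hk hlam (fun i : Fin n => x i) (x n)
    positivity
  have hdet : (1 + lam⁻¹ • gram k fun i : Fin N => x i).det = ∏ n ∈ Finset.range N,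
      (1 + lam⁻¹ * postVar k lam (fun i : Fin n => x i) (x n)) := by
    induction N with
    | zero => simp
    | succ N ih =>
      rw [Finset.prod_range_succ, ← ih, ← det_gram_sumElim hk hlam,
        ← det_gram_comp_equiv finSumFinEquiv]
      congr 4
      ext (i | i) <;> simp
  rw [infoGain, hdet, Real.log_prod fun n _ => (hpos n).ne']

/-- Follows from `log (1 + s) ≤ s`; it makes the supremum in `maxInfoGain` a genuine one. -/
lemma infoGain_le (hk : ∀ x y, k x y = ⟪φ x, φ y⟫) (hlam : 0 < lam)
    (hkmax : ∀ x, k x x ≤ kmax) (N : ℕ) (x : Fin N → Z) :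
    infoGain k lam x ≤ 1 / 2 * (N * (lam⁻¹ * kmax)) := by
  obtain rfl | hN := N.eq_zero_or_pos
  · simp [infoGain]
  obtain ⟨y, rfl⟩ : ∃ y : ℕ → Z, x = fun i : Fin N => y i :=
    ⟨fun i => if h : i < N then x ⟨i, h⟩ else x ⟨0, hN⟩, by ext i; simp⟩
  rw [infoGain_eq_sum hk hlam]
  gcongr
  rw [← nsmul_eq_mul]
  refine (Finset.sum_le_card_nsmul _ _ (lam⁻¹ * kmax) fun n _ => ?_).trans_eq (by simp)
  have h0 := postVar_nonneg hk hlam (fun i : Fin n => y i) (y n)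
  refine (Real.log_le_sub_one_of_pos (by positivity)).trans ?_
  rw [add_sub_cancel_left]
  gcongr
  exact (postVar_le_diag hk hlam _ _).trans (hkmax _)

lemma infoGain_le_maxInfoGain (hk : ∀ x y, k x y = ⟪φ x, φ y⟫) (hlam : 0 < lam)
    (hkmax : ∀ x, k x x ≤ kmax) (N : ℕ) (x : Fin N → Z) :
    infoGain k lam x ≤ maxInfoGain k lam N :=
  le_ciSup (f := fun x : Fin N → Z => infoGain k lam x)
    ⟨_, Set.forall_mem_range.2 (infoGain_le hk hlam hkmax N)⟩ x

/-- From `log s ≥ 1 - s⁻¹`, which here reads `log (1 + v / lam) ≥ v / (lam + v)`. -/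
lemma le_mul_log_one_add {v : ℝ} (hlam : 0 < lam) (hv : 0 ≤ v) (hvk : v ≤ kmax) :
    v ≤ (lam + kmax) * Real.log (1 + lam⁻¹ * v) := by
  have hpos : 0 < 1 + lam⁻¹ * v := by positivity
  have h := Real.one_sub_inv_le_log_of_pos hpos
  have h2 : 1 - (1 + lam⁻¹ * v)⁻¹ = v / (lam + v) := by
    field_simp
    ring
  rw [h2] at h
  calc v = (lam + v) * (v / (lam + v)) := by field_simp
    _ ≤ (lam + kmax) * Real.log (1 + lam⁻¹ * v) := by gcongr; linarith

/-- The posterior variances along a sequence of queries sum up to at most the maximum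
information gain, up to a constant. -/
lemma sum_postVar_le (hk : ∀ x y, k x y = ⟪φ x, φ y⟫) (hlam : 0 < lam)
    (hkmax : ∀ x, k x x ≤ kmax) (x : ℕ → Z) (N : ℕ) :
    ∑ n ∈ Finset.range N, postVar k lam (fun i : Fin n => x i) (x n) ≤
      2 * (lam + kmax) * maxInfoGain k lam N := by
  have hnn : 0 ≤ lam + kmax := by
    have := (postVar_nonneg hk hlam Fin.elim0 (x 0)).trans
      ((postVar_le_diag hk hlam _ _).trans (hkmax _))
    linarith
  calc ∑ n ∈ Finset.range N, postVar k lam (fun i : Fin n => x i) (x n)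
      ≤ ∑ n ∈ Finset.range N, (lam + kmax) *
          Real.log (1 + lam⁻¹ * postVar k lam (fun i : Fin n => x i) (x n)) :=
        Finset.sum_le_sum fun n _ => le_mul_log_one_add hlam (postVar_nonneg hk hlam _ _)
          ((postVar_le_diag hk hlam _ _).trans (hkmax _))
    _ = 2 * (lam + kmax) * infoGain k lam (fun i : Fin N => x i) := by
        rw [infoGain_eq_sum hk hlam, ← Finset.mul_sum]
        ring
    _ ≤ _ := by
        gcongr
        exact infoGain_le_maxInfoGain hk hlam hkmax N _

/-- Query `t` repeatedly: the first posterior variance is the prior one. This lets the initial steps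
be charged to the information gain, without an additive constant. -/
lemma diag_le_maxInfoGain (hk : ∀ x y, k x y = ⟪φ x, φ y⟫) (hlam : 0 < lam)
    (hkmax : ∀ x, k x x ≤ kmax) {N : ℕ} (hN : 0 < N) (t : Z) :
    k t t ≤ 2 * (lam + kmax) * maxInfoGain k lam N := by
  refine le_trans ?_ (sum_postVar_le hk hlam hkmax (fun _ => t) N)
  rw [← postVar_of_isEmpty (k := k) (lam := lam) (fun _ : Fin 0 => t) t]
  exact Finset.single_le_sum (f := fun n => postVar k lam (fun _ : Fin n => t) t)
    (fun n _ => postVar_nonneg hk hlam _ _) (Finset.mem_range.2 hN)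

/-- Batch version of `sum_postVar_le`: one point is selected in each batch, and the posterior
takes all points of the preceding batches into account. -/
lemma sum_postVar_queries_le (hk : ∀ x y, k x y = ⟪φ x, φ y⟫) (hlam : 0 < lam)
    (hkmax : ∀ x, k x x ≤ kmax) {q : ℕ} (z : ℕ → Fin q → Z) (J : ℕ → Fin q) (N : ℕ) :
    ∑ n ∈ Finset.range N, postVar k lam (queries z n) (z n (J n)) ≤
      2 * (lam + kmax) * maxInfoGain k lam N := by
  refine le_trans (Finset.sum_le_sum fun n _ => ?_)
    (sum_postVar_le hk hlam hkmax (fun n => z n (J n)) N)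
  -- Forgetting all but the selected point of each earlier batch only increases the variance.
  exact postVar_le_postVar_comp hk hlam (queries z n) (fun i : Fin n => (i, J i))
    (fun i j h => (Prod.ext_iff.1 h).1) _

end InfoGain

/-! ### Regret of the scalarized objectives -/

/-- Each index `i` is hit only by `n` in `(i, i + T]`, hence at most `T` times. -/
lemma sum_comp_le_mul_sum {v : ℕ → ℝ} (hv : ∀ i, 0 ≤ v i) {N T : ℕ} (S : Finset ℕ) (I : ℕ → ℕ)
    (hIN : ∀ n ∈ S, I n < N) (hlt : ∀ n ∈ S, I n < n) (hle : ∀ n ∈ S, n ≤ I n + T) :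
    ∑ n ∈ S, v (I n) ≤ T * ∑ i ∈ Finset.range N, v i := by
  rw [← Finset.sum_fiberwise_of_maps_to (g := I) (t := Finset.range N)
    fun n hn => Finset.mem_range.2 (hIN n hn), Finset.mul_sum]
  refine Finset.sum_le_sum fun i _ => ?_
  rw [Finset.sum_congr rfl fun n hn => by rw [(Finset.mem_filter.1 hn).2], Finset.sum_const,
    nsmul_eq_mul]
  refine mul_le_mul_of_nonneg_right ?_ (hv i)
  have hsub : {n ∈ S | I n = i} ⊆ Finset.Ioc i (i + T) := by
    intro n hn
    obtain ⟨hnS, rfl⟩ := Finset.mem_filter.1 hn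
    exact Finset.mem_Ioc.2 ⟨hlt n hnS, hle n hnS⟩
  exact_mod_cast (Finset.card_le_card hsub).trans_eq (by simp)

lemma finite_evaluated {Z : Type*} {q : ℕ} (z : ℕ → Fin q → Z) (n : ℕ) :
    (evaluated z n).Finite := by
  refine (Set.finite_range (queries z n)).subset ?_
  rintro _ ⟨i, hi, j, rfl⟩
  exact ⟨(⟨i, hi⟩, j), rfl⟩

lemma scalGap_le {Z : Type*} [Nonempty Z] {s : Z → ℝ} {A : Set Z} (hA : A.Finite) {a : Z}
    (ha : a ∈ A) {c : ℝ} (h : ∀ x, s x ≤ s a + c) : scalGap s A ≤ c := by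
  have h1 : s a ≤ sSup (s '' A) := le_csSup (hA.image s).bddAbove (Set.mem_image_of_mem s ha)
  have h2 : ⨆ x, s x ≤ s a + c := ciSup_le h
  rw [scalGap]
  linarith

section Regret

variable {Z E : Type*} [Nonempty Z] [NormedAddCommGroup E] [InnerProductSpace ℝ E]
  {k : Z → Z → ℝ} {φ : Z → E} {lam kmax : ℝ} {K M q : ℕ} {β : ℕ → ℝ} {T N : ℕ}
  {w : Fin K → Fin M → ℝ} {f : Z → Fin M → ℝ} {e : Fin M → ℕ → Fin q → ℝ} {z : ℕ → Fin q → Z}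

/-- The optimality gap after a step at which the upper confidence bound was maximized. -/
lemma scalGap_le_of_ucb_max (hβ : Monotone β) (hconf : ConfidenceEvent k lam β w f e z N)
    (κ : Fin K) {i n : ℕ} (hin : i < n) (hnN : n ≤ N) {j : Fin q}
    (hmax : ∀ x, ucb k lam β (w κ) f e z i x ≤ ucb k lam β (w κ) f e z i (z i j)) :
    scalGap (scal (w κ) f) (evaluated z n) ≤ 2 * √(β N) * postStd k lam z i (z i j) := by
  refine scalGap_le (finite_evaluated z n) (a := z i j) ⟨i, hin, j, rfl⟩ fun x => ?_
  have hiN : i < N := hin.trans_le hnN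
  have h1 := (abs_le.1 (hconf κ i hiN x)).2
  have h2 := (abs_le.1 (hconf κ i hiN (z i j))).1
  have h3 := hmax x
  simp only [ucb] at h3
  have h4 : √(β (i + 1)) * postStd k lam z i (z i j) ≤ √(β N) * postStd k lam z i (z i j) :=
    mul_le_mul_of_nonneg_right (Real.sqrt_le_sqrt (hβ hiN)) (Real.sqrt_nonneg _)
  linarith

/-- The optimality gap implied by the confidence bounds for the prior. -/
lemma scalGap_le_of_diag_le (hq : 1 ≤ q) (hβ : Monotone β)
    (hconf : ConfidenceEvent k lam β w f e z N) (κ : Fin K) {n : ℕ} (hn : 1 ≤ n) (hnN : n ≤ N)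
    {D : ℝ} (hD : ∀ x, k x x ≤ D) :
    scalGap (scal (w κ) f) (evaluated z n) ≤ 2 * √(β N) * √D := by
  have hN : 0 < N := hn.trans hnN
  have key (x : Z) : |scal (w κ) f x| ≤ √(β N) * √D := by
    -- Before any data the posterior mean is zero and the variance is `k x x`.
    have h := hconf κ 0 hN x
    rw [scalMean, postMean, postStd, postVar_of_isEmpty] at h
    simp only [dotProduct, Finset.univ_eq_empty, Finset.sum_empty, sub_zero] at h
    refine h.trans ?_
    gcongr
    exacts [hβ hN, hD x]
  refine scalGap_le (finite_evaluated z n) (a := z 0 ⟨0, hq⟩) ⟨0, hn, _, rfl⟩ fun x => ?_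
  have h1 := (abs_le.1 (key x)).2
  have h2 := (abs_le.1 (key (z 0 ⟨0, hq⟩))).1
  linarith

lemma sum_scalGap_le (hk : ∀ x y, k x y = ⟪φ x, φ y⟫) (hlam : 0 < lam) (hkmax : ∀ x, k x x ≤ kmax)
    (hq : 1 ≤ q) (hβ0 : ∀ n, 0 ≤ β n) (hβ : Monotone β)
    (hucb : IsGPUCB k lam β T w f e z) (hconf : ConfidenceEvent k lam β w f e z N) (κ : Fin K) :
    ∑ n ∈ Finset.Icc 1 N, scalGap (scal (w κ) f) (evaluated z n) ≤
      4 * √(lam + kmax) * √T * √(N * β N * maxInfoGain k lam N) := by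
  set D := 2 * (lam + kmax) * maxInfoGain k lam N with hD
  have hk0 : 0 ≤ lam + kmax := by
    obtain ⟨t⟩ := ‹Nonempty Z›
    have := (postVar_nonneg hk hlam Fin.elim0 t).trans
      ((postVar_le_diag hk hlam _ _).trans (hkmax _))
    linarith
  have : Nonempty (Fin q) := ⟨⟨0, hq⟩⟩
  choose I hI1 hI2 j hj using fun n => hucb κ n
  -- The most uncertain point of each batch dominates the UCB maximizer there, and its choice
  -- depends on the batch alone.
  choose J hJ using fun i => Finite.exists_max fun j => postVar k lam (queries z i) (z i j)
  set v : ℕ → ℝ := fun i => postVar k lam (queries z i) (z i (J i))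
  have hv0 (i) : 0 ≤ v i := postVar_nonneg hk hlam _ _
  have hvD : ∑ i ∈ Finset.range N, v i ≤ D := sum_postVar_queries_le hk hlam hkmax z J N
  have hD0 : 0 ≤ D := (Finset.sum_nonneg fun i _ => hv0 i).trans hvD
  -- For `n ≥ T` the zero-based steps `n - T, ..., n - 1` contain one serving `κ`; for `n < T` there
  -- may be none yet, and the prior bound is used.
  let g : ℕ → ℝ := fun n => if n < T then √D else √(v (I (n - T)))
  have hgap : ∀ n ∈ Finset.Icc 1 N,
      scalGap (scal (w κ) f) (evaluated z n) ≤ 2 * √(β N) * g n := by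
    intro n hn
    obtain ⟨hn1, hnN⟩ := Finset.mem_Icc.1 hn
    by_cases hnT : n < T
    · simp only [g, if_pos hnT]
      exact scalGap_le_of_diag_le hq hβ hconf κ hn1 hnN fun x =>
        diag_le_maxInfoGain hk hlam hkmax (hn1.trans hnN) x
    · simp only [g, if_neg hnT]
      have hlt := hI2 (n - T)
      refine (scalGap_le_of_ucb_max hβ hconf κ (by omega) hnN (hj (n - T))).trans ?_
      exact mul_le_mul_of_nonneg_left (Real.sqrt_le_sqrt (hJ _ _)) (by positivity)
  -- One `T * D` pays for the initial steps, the other for each served step being reused up to `T`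
  -- times.
  have hgsq : ∑ n ∈ Finset.Icc 1 N, g n ^ 2 ≤ 2 * (T * D) := by
    have hgn (n : ℕ) : g n ^ 2 = if n < T then D else v (I (n - T)) := by
      simp only [g]
      split_ifs
      exacts [Real.sq_sqrt hD0, Real.sq_sqrt (hv0 _)]
    simp_rw [hgn]
    rw [Finset.sum_ite, Finset.sum_const, nsmul_eq_mul, two_mul]
    refine add_le_add (mul_le_mul_of_nonneg_right ?_ hD0) ?_
    · have hsub : {n ∈ Finset.Icc 1 N | n < T} ⊆ Finset.range T := fun n hn =>
        Finset.mem_range.2 (Finset.mem_filter.1 hn).2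
      exact_mod_cast (Finset.card_le_card hsub).trans_eq (by simp)
    · refine (sum_comp_le_mul_sum (N := N) (T := T) hv0 _ (fun n => I (n - T)) ?_ ?_ ?_).trans
        (by gcongr) <;>
      · intro n hn
        have h1 := hI1 (n - T)
        have h2 := hI2 (n - T)
        simp only [Finset.mem_filter, Finset.mem_Icc, not_lt] at hn
        omega
  have hgsum : ∑ n ∈ Finset.Icc 1 N, g n ≤ √(N * (2 * (T * D))) := by
    apply Real.le_sqrt_of_sq_le
    refine sq_sum_le_card_mul_sum_sq.trans ?_
    rw [Nat.card_Icc, Nat.add_sub_cancel]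
    gcongr
  calc ∑ n ∈ Finset.Icc 1 N, scalGap (scal (w κ) f) (evaluated z n)
      ≤ 2 * √(β N) * ∑ n ∈ Finset.Icc 1 N, g n := by
        rw [Finset.mul_sum]
        exact Finset.sum_le_sum hgap
    _ ≤ 2 * √(β N) * √(N * (2 * (T * D))) := by gcongr
    -- The `2 ^ 2` collects the factor 2 of `hgsq` and the one in `D`.
    _ = 2 * √(2 ^ 2 * ((lam + kmax) * (T * (N * β N * maxInfoGain k lam N)))) := by
        rw [mul_assoc, ← Real.sqrt_mul (hβ0 N), hD]
        ring_nf
    _ = _ := by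
        rw [Real.sqrt_mul (by positivity), Real.sqrt_sq zero_le_two, Real.sqrt_mul hk0,
          Real.sqrt_mul (Nat.cast_nonneg T)]
        ring

lemma hvRegret_le (hk : ∀ x y, k x y = ⟪φ x, φ y⟫) (hlam : 0 < lam) (hkmax : ∀ x, k x x ≤ kmax)
    (hq : 1 ≤ q) (hβ0 : ∀ n, 0 ≤ β n) (hβ : Monotone β) {r : Fin M → ℝ} {α : Fin K → ℝ} {ε : ℝ}
    (hdec : HVDecomposition f r w α ε)
    (hucb : IsGPUCB k lam β T w f e z) (hconf : ConfidenceEvent k lam β w f e z N) :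
    hvRegret f r z N ≤ N * ε + 4 * √(lam + kmax) * √(T : ℝ) * (∑ κ, α κ) *
      √(N * β N * maxInfoGain k lam N) := by
  calc hvRegret f r z N
      ≤ ∑ n ∈ Finset.Icc 1 N, (ε + ∑ κ, α κ * scalGap (scal (w κ) f) (evaluated z n)) :=
        Finset.sum_le_sum fun n hn => hdec.deficiency_le _ (finite_evaluated z n)
          ⟨z 0 ⟨0, hq⟩, 0, (Finset.mem_Icc.1 hn).1, _, rfl⟩
    _ = N * ε + ∑ κ, α κ * ∑ n ∈ Finset.Icc 1 N, scalGap (scal (w κ) f) (evaluated z n) := by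
        rw [Finset.sum_add_distrib, Finset.sum_comm]
        simp [Finset.mul_sum]
    _ ≤ N * ε + ∑ κ, α κ *
          (4 * √(lam + kmax) * √T * √(N * β N * maxInfoGain k lam N)) := by
        gcongr with κ
        · exact hdec.coeff_nonneg κ
        · exact sum_scalGap_le hk hlam hkmax hq hβ0 hβ hucb hconf κ
    _ = _ := by
        rw [← Finset.sum_mul]
        ring

end Regret

/-! ### Tail thresholds for sub-Gaussian noise -/

/-- Chernoff bound with exponent fixed at 1, for both signs; an optimized exponent is not needed. -/
lemma measure_le_abs_le {Ω : Type*} [MeasurableSpace Ω] {P : Measure Ω} [IsProbabilityMeasure P]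
    {X : Ω → ℝ} {c : ℝ≥0} (hX : HasSubgaussianMGF X c P) (u : ℝ) :
    P {ω | u ≤ |X ω|} ≤ ENNReal.ofReal (2 * Real.exp (c / 2 - u)) := by
  have key {Y : Ω → ℝ} (hY : HasSubgaussianMGF Y c P) :
      P {ω | u ≤ Y ω} ≤ ENNReal.ofReal (Real.exp (c / 2 - u)) := by
    rw [← ofReal_measureReal]
    refine ENNReal.ofReal_le_ofReal ?_
    refine (measure_ge_le_exp_mul_mgf u zero_le_one (hY.integrable_exp_mul 1)).trans ?_
    refine (mul_le_mul_of_nonneg_left (hY.mgf_le 1) (Real.exp_pos _).le).trans_eq ?_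
    rw [← Real.exp_add]
    ring_nf
  have hsub : {ω | u ≤ |X ω|} ⊆ {ω | u ≤ X ω} ∪ {ω | u ≤ (-X) ω} := by
    intro ω hω
    simpa [le_abs] using hω
  refine (measure_mono hsub).trans ((measure_union_le _ _).trans ?_)
  rw [two_mul, ENNReal.ofReal_add (Real.exp_pos _).le (Real.exp_pos _).le]
  exact add_le_add (key hX) (key hX.neg)

/-- Thresholds that countably many sub-Gaussian variables respect simultaneously with high
probability, whatever their joint law. -/
lemma exists_thresholds {ι : Type*} [Countable ι] (c : ℝ≥0) {δ : ℝ} (hδ : 0 < δ) :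
    ∃ u : ι → ℝ, (∀ a, 0 ≤ u a) ∧
      ∀ (Ω : Type*) [MeasurableSpace Ω] (P : Measure Ω) [IsProbabilityMeasure P] (X : ι → Ω → ℝ),
        (∀ a, HasSubgaussianMGF (X a) c P) → HoldsWithProb P δ fun ω => ∀ a, |X a ω| ≤ u a := by
  obtain ⟨η, hη, hsum⟩ :=
    ENNReal.exists_pos_sum_of_countable (ENNReal.ofReal_pos.2 hδ).ne' ι
  -- Solves `2 * exp (c / 2 - u) = η a` for `u`; the absolute value keeps the threshold nonnegative.
  refine ⟨fun a => |c / 2 - Real.log (η a / 2)|, fun a => abs_nonneg _, ?_⟩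
  intro Ω _ P _ X hX
  have hsub : {ω | ¬ ∀ a, |X a ω| ≤ |c / 2 - Real.log (η a / 2)|} ⊆
      ⋃ a, {ω | |c / 2 - Real.log (η a / 2)| ≤ |X a ω|} := by
    intro ω hω
    obtain ⟨a, ha⟩ := not_forall.1 hω
    exact Set.mem_iUnion.2 ⟨a, (not_le.1 ha).le⟩
  refine (measure_mono hsub).trans ((measure_iUnion_le _).trans (le_trans ?_ hsum.le))
  refine ENNReal.tsum_le_tsum fun a => (measure_le_abs_le (hX a) _).trans ?_
  rw [← ENNReal.ofReal_coe_nnreal]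
  refine ENNReal.ofReal_le_ofReal ?_
  have hpos : (0 : ℝ) < η a / 2 := by have := hη a; positivity
  have h : c / 2 - |c / 2 - Real.log (η a / 2)| ≤ Real.log (η a / 2) := by
    linarith [le_abs_self (c / 2 - Real.log (η a / 2))]
  calc 2 * Real.exp (c / 2 - |c / 2 - Real.log (η a / 2)|)
      ≤ 2 * Real.exp (Real.log (η a / 2)) := by gcongr
    _ = η a := by
      rw [Real.exp_log hpos]
      ring

lemma HoldsWithProb.mono {Ω : Type*} [MeasurableSpace Ω] {P : Measure Ω} {δ : ℝ} {A B : Ω → Prop}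
    (hA : HoldsWithProb P δ A) (h : ∀ ω, A ω → B ω) : HoldsWithProb P δ B :=
  le_trans (measure_mono (Set.ofPred_subset_ofPred.2 fun ω hω hAω => hω (h ω hAω))) hA

/-! ### Confidence bounds in the RKHS -/

section Confidence

variable {Z : Type*} (H : Type*) [NormedAddCommGroup H] [InnerProductSpace ℝ H] [CompleteSpace H]
  [RKHS ℝ H Z ℝ] {K M q : ℕ}

/-- Supplies the feature map `φ x = RKHS.kerFun H x 1` for the abstract estimates above. -/
lemma kern_eq_inner (x y : Z) :
    kern H x y = ⟪RKHS.kerFun H x (1 : ℝ), RKHS.kerFun H y (1 : ℝ)⟫ := by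
  rw [RKHS.kerFun_inner, RKHS.kerFun_apply, kern]
  simp

variable {H}

lemma scal_eq_inner (w : Fin M → ℝ) (f : Fin M → H) (x : Z) :
    scal w (fun x m => f m x) x = ⟪∑ m, w m • f m, RKHS.kerFun H x (1 : ℝ)⟫ := by
  rw [sum_inner]
  refine Finset.sum_congr rfl fun m _ => ?_
  rw [real_inner_smul_left, RKHS.inner_kerFun]
  simp

/-- The square root of the confidence multiplier obtained from bounds `B` on the norms of the
objectives and bounds `u` on the noise. -/
def confRadius (lam : ℝ) (w : Fin K → Fin M → ℝ) (B : Fin M → ℝ)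
    (u : Fin M × ℕ × Fin q → ℝ) (n : ℕ) : ℝ :=
  ∑ κ, (∑ m, |w κ m| * |B m| +
    (√lam)⁻¹ * ∑ i ∈ Finset.range n, ∑ j, ∑ m, |w κ m| * u (m, i, j))

variable {lam : ℝ} {w : Fin K → Fin M → ℝ} {B : Fin M → ℝ} {u : Fin M × ℕ × Fin q → ℝ}

lemma confRadius_summand_nonneg (hu : ∀ a, 0 ≤ u a) (κ : Fin K) (n : ℕ) :
    0 ≤ ∑ m, |w κ m| * |B m| +
      (√lam)⁻¹ * ∑ i ∈ Finset.range n, ∑ j, ∑ m, |w κ m| * u (m, i, j) := by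
  have (i : ℕ) (j : Fin q) (m : Fin M) : 0 ≤ |w κ m| * u (m, i, j) :=
    mul_nonneg (abs_nonneg _) (hu _)
  have : 0 ≤ ∑ i ∈ Finset.range n, ∑ j, ∑ m, |w κ m| * u (m, i, j) :=
    Finset.sum_nonneg fun i _ => Finset.sum_nonneg fun j _ => Finset.sum_nonneg fun m _ => this i j m
  positivity

lemma confRadius_nonneg (hu : ∀ a, 0 ≤ u a) (n : ℕ) : 0 ≤ confRadius lam w B u n :=
  Finset.sum_nonneg fun κ _ => confRadius_summand_nonneg hu κ n

lemma confRadius_mono (hu : ∀ a, 0 ≤ u a) : Monotone (confRadius lam w B u) := by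
  intro n n' h
  unfold confRadius
  gcongr with κ
  exact fun i _ _ => Finset.sum_nonneg fun j _ => Finset.sum_nonneg fun m _ =>
    mul_nonneg (abs_nonneg _) (hu _)

lemma confidenceEvent_of_noise_le (hlam : 0 < lam) (hu : ∀ a, 0 ≤ u a)
    {f : Fin M → H} (hf : ∀ m, ‖f m‖ ≤ B m) {e : Fin M → ℕ → Fin q → ℝ}
    (he : ∀ m i j, |e m i j| ≤ u (m, i, j)) (z : ℕ → Fin q → Z) (N : ℕ) :
    ConfidenceEvent (kern H) lam (fun n => confRadius lam w B u n ^ 2) w (fun x m => f m x) e z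
      N := by
  intro κ n _ x
  have hobs : scalObs (w κ) (fun x m => f m x) e z n = fun a =>
      ⟪∑ m, w κ m • f m, RKHS.kerFun H (queries z n a) (1 : ℝ)⟫ + ∑ m, w κ m * e m a.1 a.2 := by
    ext a
    rw [← scal_eq_inner]
    simp [scalObs, scal, queries, mul_add, Finset.sum_add_distrib]
  rw [Real.sqrt_sq (confRadius_nonneg hu _), scalMean, hobs, scal_eq_inner]
  refine (abs_sub_postMean_le (kern_eq_inner H) hlam (queries z n) _ _ x).trans ?_
  refine mul_le_mul_of_nonneg_right ?_ (Real.sqrt_nonneg _)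
  -- Only `n` noisy steps enter, while the multiplier has index `n + 1`.
  refine le_trans ?_ (confRadius_mono hu n.le_succ)
  refine le_trans ?_ (Finset.single_le_sum (fun κ _ => confRadius_summand_nonneg hu κ n)
    (Finset.mem_univ κ))
  have hnoise : ∑ a : Fin n × Fin q, |∑ m, w κ m * e m a.1 a.2| ≤
      ∑ i ∈ Finset.range n, ∑ j, ∑ m, |w κ m| * u (m, i, j) := by
    rw [Fintype.sum_prod_type,
      Finset.sum_range fun i => ∑ j, ∑ m, |w κ m| * u (m, i, j)]
    refine Finset.sum_le_sum fun i _ => Finset.sum_le_sum fun j _ =>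
      (Finset.abs_sum_le_sum_abs _ _).trans (Finset.sum_le_sum fun m _ => ?_)
    rw [abs_mul]
    exact mul_le_mul_of_nonneg_left (he _ _ _) (abs_nonneg _)
  refine add_le_add ((norm_sum_le _ _).trans (Finset.sum_le_sum fun m _ => ?_)) (by gcongr)
  rw [norm_smul, Real.norm_eq_abs]
  exact mul_le_mul_of_nonneg_left ((hf m).trans (le_abs_self _)) (abs_nonneg _)

end Confidence

end HVBandit

end

theorem proposition1 (kmax lam : ℝ) (hkmax : 0 < kmax) (hlam : 0 < lam) :
    ∃ C : ℝ, 0 < C ∧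
      ∀ (Z : Type*) [TopologicalSpace Z] [CompactSpace Z] [Nonempty Z]
        (H : Type*) [NormedAddCommGroup H] [InnerProductSpace ℝ H] [CompleteSpace H]
        [RKHS ℝ H Z ℝ],
        Continuous (fun p : Z × Z => HVBandit.kern H p.1 p.2) →
        (∀ x : Z, HVBandit.kern H x x ≤ kmax) →
      ∀ (K M q : ℕ), 1 ≤ q →
      ∀ (w : Fin K → Fin M → ℝ) (B : Fin M → ℝ) (σ : ℝ≥0) (δ : ℝ), 0 < δ → δ < 1 →
        -- confidence multipliers exist, uniformly over objectives, noise and query rules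
        (∃ β : ℕ → ℝ, (∀ n, 0 ≤ β n) ∧ Monotone β ∧
          ∀ (f : Fin M → H), (∀ m, ‖f m‖ ≤ B m) →
          ∀ (Ω : Type*) [MeasurableSpace Ω] (P : Measure Ω) [IsProbabilityMeasure P]
            (noise : Fin M → ℕ → Fin q → Ω → ℝ), HVBandit.SubGaussianNoise P σ noise →
          ∀ z : ℕ → Fin q → Ω → Z,
            HVBandit.HoldsWithProb P δ fun ω => ∀ N,
              HVBandit.ConfidenceEvent (HVBandit.kern H) lam β w (fun x m => f m x)
                (fun m i j => noise m i j ω) (fun i j => z i j ω) N) ∧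
        -- the regret bound, for every choice of confidence multipliers
        (∀ (f : Fin M → H), (∀ m, ‖f m‖ ≤ B m) →
          ∀ (r : Fin M → ℝ) (α : Fin K → ℝ) (ε : ℝ),
            HVBandit.HVDecomposition (fun x m => f m x) r w α ε →
          ∀ (Ω : Type*) [MeasurableSpace Ω] (P : Measure Ω) [IsProbabilityMeasure P]
            (noise : Fin M → ℕ → Fin q → Ω → ℝ), HVBandit.SubGaussianNoise P σ noise →
          ∀ (T : ℕ), 1 ≤ T →
          ∀ (β : ℕ → ℝ), (∀ n, 0 ≤ β n) → Monotone β →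
          ∀ z : ℕ → Fin q → Ω → Z,
            (∀ ω, HVBandit.IsGPUCB (HVBandit.kern H) lam β T w (fun x m => f m x)
              (fun m i j => noise m i j ω) (fun i j => z i j ω)) →
          ∀ N : ℕ,
            HVBandit.HoldsWithProb P δ (fun ω =>
              HVBandit.ConfidenceEvent (HVBandit.kern H) lam β w (fun x m => f m x)
                (fun m i j => noise m i j ω) (fun i j => z i j ω) N) →
            HVBandit.HoldsWithProb P δ (fun ω =>
              HVBandit.hvRegret (fun x m => f m x) r (fun i j => z i j ω) N ≤
                N * ε + C * √(T : ℝ) * (∑ κ, α κ) *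
                  √(N * β N * HVBandit.maxInfoGain (Z := Z) (HVBandit.kern H) lam N))) := by
  refine ⟨4 * √(lam + kmax), by positivity, ?_⟩
  intro Z _ _ _ H _ _ _ _ _ hk K M q hq w B σ δ hδ _
  refine ⟨?_, ?_⟩
  · obtain ⟨u, hu, hprob⟩ :=
      HVBandit.exists_thresholds (ι := Fin M × ℕ × Fin q) (σ ^ 2) hδ
    refine ⟨fun n => HVBandit.confRadius lam w B u n ^ 2, fun n => sq_nonneg _,
      fun n n' h => pow_le_pow_left₀ (HVBandit.confRadius_nonneg hu n)
        (HVBandit.confRadius_mono hu h) 2, ?_⟩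
    intro f hf Ω _ P _ noise hnoise z
    -- The noise event does not involve `z`, so any adaptive query rule is allowed.
    refine (hprob Ω P (fun a => noise a.1 a.2.1 a.2.2) fun a => hnoise.subGaussian _ _ _).mono ?_
    intro ω hω N
    exact HVBandit.confidenceEvent_of_noise_le hlam hu hf (fun m i j => hω (m, i, j)) _ N
  · intro f _ r α ε hdec Ω _ P _ noise _ T _ β hβ0 hβ z hucb N hconf
    exact hconf.mono fun ω hω => HVBandit.hvRegret_le (HVBandit.kern_eq_inner H) hlam hk hq hβ0 hβ
      hdec (hucb ω) hω
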